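/- Let $K$ be an abstract simplicial complex on the finite set $[m]=\{1,\dots,m\}$ (elements of $[m]$ that are not vertices of $K$ are allowed). Call a vertex $i$ of $K$ conelike if $\{i,j\}\in K$ for every other vertex $j$ of $K$. Let $D^4\subset\mathbb{H}$ be the closed unit ball of the quaternions, let $S^3=\partial D^4$, and let $$Z_K(D^4,S^3)=\bigcup_{J\in K}\Big(\prod_{i\in J}D^4\times\prod_{i\notin J}S^3\Big)\subseteq (D^4)^m$$ be the quaternionic moment-angle complex of $K$, where $J$ runs over all simplices of $K$, including the empty one. If $K$ has at least one vertex that is not conelike, then $Z_K(D^4,S^3)$ is not aspherical, that is, $\pi_n(Z_K(D^4,S^3),x)\neq 0$ for some $n\ge 2$ and some base point $x$. -/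

import Mathlib

open scoped Topology Quaternion

/-- A vertex `i` of `K` is conelike if it is joined by an edge to every other vertex of `K`.
A vertex of `K` is an `i` with `{i} ∈ K`. -/
def IsConelike {ι : Type*} [DecidableEq ι] (K : PreAbstractSimplicialComplex ι) (i : ι) : Prop :=
  ∀ j, j ≠ i → {j} ∈ K → {i, j} ∈ K

/-- The polyhedral product of a family of pairs `(A i, B i)` of subspaces of `X i`: the union over
the simplices `J` of `K` of the products of the `A i`, `i ∈ J`, and the `B i`, `i ∉ J`, as a
subspace of the product of the `X i`. The empty simplex, which Mathlib does not list among the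
faces, belongs to every simplicial complex and is added here. -/
def polyhedralProduct {ι : Type*} {X : ι → Type*} (K : PreAbstractSimplicialComplex ι)
    (A B : ∀ i, Set (X i)) : Set (∀ i, X i) :=
  {x | ∃ J : Finset ι, (J = ∅ ∨ J ∈ K) ∧ (∀ i ∈ J, x i ∈ A i) ∧ ∀ i, i ∉ J → x i ∈ B i}

/-- The quaternionic moment-angle complex of `K`, the polyhedral product of the pair formed by the
closed unit ball and the unit sphere of the quaternions. -/
def quaternionicMomentAngleComplex {ι : Type*} (K : PreAbstractSimplicialComplex ι) :
    Set (ι → ℍ[ℝ]) :=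
  polyhedralProduct K (fun _ => Metric.closedBall 0 1) (fun _ => Metric.sphere 0 1)

/-- All homotopy groups in degrees at least two vanish, at every base point. Connectedness is not
required; so the negation says that some higher homotopy group is nontrivial. -/
def IsAspherical (X : Type*) [TopologicalSpace X] : Prop :=
  ∀ n : ℕ, 2 ≤ n → ∀ x : X, Subsingleton (π_ n X x)

/-! A non-conelike vertex `i` has a vertex `j` with `{i, j}` not in `K`. Projecting to the
coordinates `i`, `j` lands in the boundary of `D⁴ × D⁴`, the unit sphere of `ℍ × ℍ` in the max norm,
hence a topological `S⁷`. Setting all other coordinates to `1` gives a section, so `S⁷` is a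
retract, and asphericity passes to retracts. It remains to see that `π₇(S⁷)` is nontrivial. For
`πₙ(Sⁿ)`, a nullhomotopy of a loop winding once would build a zero-free self-map of `ℝⁿ⁺¹` equal to
the identity far out, hence a `C¹` retraction onto a sphere. Such a map `g = id + h` cannot exist:
the integral over the ball of `det (1 + t • Dh)` is polynomial in `t` and equals the volume for
small `t`, so also at `t = 1`, where the Jacobian of a sphere-valued map vanishes. -/

/-! ### Determinants of perturbations of the identity -/

open Polynomial in
/-- The determinant of `1 + x • A` is recovered by Lagrange interpolation from its values at more
than `finrank ℝ E` nodes. -/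
theorem ContinuousLinearMap.det_one_add_smul_eq_sum_lagrange {E : Type*} [NormedAddCommGroup E]
    [NormedSpace ℝ E] [FiniteDimensional ℝ E] (A : E →L[ℝ] E) (s : Finset ℝ)
    (hs : Module.finrank ℝ E < s.card) (x : ℝ) :
    (1 + x • A).det = ∑ k ∈ s, (1 + k • A).det * (Lagrange.basis s id k).eval x := by
  classical
  let b := Module.finBasis ℝ E
  let M := LinearMap.toMatrix b b (A : E →ₗ[ℝ] E)
  let p : ℝ[X] := Matrix.det ((X : ℝ[X]) • M.map C + (1 : Matrix _ _ ℝ).map C)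
  have hp : ∀ y : ℝ, p.eval y = (1 + y • A).det := by
    intro y
    have h1 : p.eval y = Matrix.det (y • M + 1) := by
      have := RingHom.map_det (evalRingHom y) ((X : ℝ[X]) • M.map C + (1 : Matrix _ _ ℝ).map C)
      rw [coe_evalRingHom] at this
      rw [this]
      congr 1
      ext i j
      by_cases hij : i = j
      · subst hij
        simp [mul_comm (M i i) y]
      · simp [hij, mul_comm (M i j) y]
    rw [h1, ContinuousLinearMap.det, ← LinearMap.det_toMatrix b]
    congr 1
    rw [add_comm]
    simp [M, LinearMap.toMatrix_one]
  have hd : p.degree < s.card := by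
    refine lt_of_le_of_lt degree_le_natDegree ?_
    refine lt_of_le_of_lt (Nat.cast_le.2 (natDegree_det_X_add_C_le M 1)) ?_
    simpa using hs
  have h2 := congrArg (eval x) (Lagrange.eq_interpolate (v := id) (Set.injOn_id _) hd)
  rw [hp, Lagrange.interpolate_apply, eval_finsetSum] at h2
  rw [h2]
  refine Finset.sum_congr rfl fun k _ => ?_
  rw [eval_mul, eval_C, hp, id]

/-- No `1 + t • A` with `t ∈ [0, 1]` has a kernel, since `‖A‖ < 1`; the determinant thus keeps the
sign it has at `t = 0`. -/
theorem ContinuousLinearMap.det_one_add_pos_of_norm_lt_one {E : Type*} [NormedAddCommGroup E]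
    [NormedSpace ℝ E] [FiniteDimensional ℝ E] (A : E →L[ℝ] E) (hA : ‖A‖ < 1) :
    0 < (1 + A).det := by
  have hne : ∀ t ∈ Set.Icc (0 : ℝ) 1, (1 + t • A).det ≠ 0 := by
    intro t ht h0
    have hk := LinearMap.bot_lt_ker_of_det_eq_zero h0
    obtain ⟨v, hv, hv0⟩ := Submodule.exists_mem_ne_zero_of_ne_bot hk.ne'
    have hv' : v + t • A v = 0 := by simpa using hv
    have h1 : ‖v‖ = t * ‖A v‖ := by
      conv_lhs => rw [eq_neg_of_add_eq_zero_left hv', norm_neg, norm_smul, Real.norm_of_nonneg ht.1]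
    have h2 := A.le_opNorm v
    have h3 : 0 < ‖v‖ := norm_pos_iff.2 hv0
    have h4 : t * ‖A v‖ ≤ 1 * ‖A v‖ := mul_le_mul_of_nonneg_right ht.2 (norm_nonneg _)
    nlinarith
  by_contra! hneg
  have hc : ContinuousOn (fun t : ℝ => (1 + t • A).det) (Set.Icc 0 1) :=
    (ContinuousLinearMap.continuous_det.comp (by fun_prop)).continuousOn
  have := intermediate_value_Icc' zero_le_one hc
  obtain ⟨t, ht, h0⟩ := this ⟨by simpa using hneg, by simp [ContinuousLinearMap.det]⟩
  exact hne t ht h0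

/-! ### No `C¹` retraction onto the sphere -/

/-- A map that is Lipschitz on a closed set and vanishes on its frontier stays Lipschitz
when it is extended by zero. -/
theorem LipschitzOnWith.indicator_of_eq_zero_frontier {E F : Type*} [NormedAddCommGroup E]
    [NormedSpace ℝ E] [NormedAddCommGroup F] {C : NNReal} {h : E → F} {s : Set E}
    (hh : LipschitzOnWith C h s) (hs : IsClosed s) (h0 : ∀ x ∈ frontier s, h x = 0) :
    LipschitzWith C (s.indicator h) := by
  have key : ∀ x ∈ s, ∀ y ∉ s, ‖h x‖ ≤ C * ‖x - y‖ := by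
    intro x hx y hy
    -- The segment from `x` to `y` crosses the frontier at some `z`, where `h` vanishes and which is
    -- no farther from `x` than `y` is.
    have hconn : IsPreconnected (segment ℝ x y) := (convex_segment x y).isPreconnected
    obtain ⟨z, hz, hzf⟩ := isPreconnected_closed_iff.1 hconn s (closure sᶜ) hs isClosed_closure
      (fun z _ => (em (z ∈ s)).imp_right fun h => subset_closure h)
      ⟨x, left_mem_segment ℝ x y, hx⟩ ⟨y, right_mem_segment ℝ x y, subset_closure hy⟩
    rw [show s ∩ closure sᶜ = frontier s by
      rw [frontier_eq_closure_inter_closure, hs.closure_eq]] at hzf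
    have h1 := hh.norm_sub_le hx (hs.frontier_subset hzf)
    rw [h0 z hzf, sub_zero] at h1
    refine h1.trans (mul_le_mul_of_nonneg_left ?_ C.2)
    have := mem_segment_iff_wbtw.1 hz
    have h2 := this.dist_add_dist
    rw [← dist_eq_norm, ← dist_eq_norm]
    linarith [dist_nonneg (x := z) (y := y)]
  refine LipschitzWith.of_dist_le_mul fun x y => ?_
  by_cases hx : x ∈ s <;> by_cases hy : y ∈ s
  · simpa [hx, hy] using hh.dist_le_mul x hx y hy
  · simpa [hx, hy, dist_eq_norm] using key x hx y hy
  · rw [dist_comm, dist_comm x]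
    simpa [hx, hy, dist_eq_norm] using key y hy x hx
  · simp only [Set.indicator_of_notMem hx, Set.indicator_of_notMem hy, dist_self]
    positivity

/-- A small Lipschitz perturbation of the identity of a closed set that fixes the frontier
is a bijection of that set. -/
theorem LipschitzOnWith.bijOn_add_of_eq_zero_frontier {E : Type*} [NormedAddCommGroup E]
    [NormedSpace ℝ E] [CompleteSpace E] {C : NNReal} (hC : C < 1) {h : E → E} {s : Set E}
    (hh : LipschitzOnWith C h s) (hs : IsClosed s) (h0 : ∀ x ∈ frontier s, h x = 0) :
    Set.BijOn (fun x => x + h x) s s := by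
  have hlip := hh.indicator_of_eq_zero_frontier hs h0
  set k := s.indicator h with hk
  have happ : ApproximatesLinearOn (fun x => x + k x)
      ((ContinuousLinearEquiv.refl ℝ E : E ≃L[ℝ] E) : E →L[ℝ] E) Set.univ C := by
    intro x _ y _
    have := hlip.norm_sub_le x y
    have heq : x + k x - (y + k y) - (x - y) = k x - k y := by abel
    rwa [← heq] at this
  have hc : Subsingleton E ∨
      C < ‖((ContinuousLinearEquiv.refl ℝ E).symm : E →L[ℝ] E)‖₊⁻¹ := by
    rcases subsingleton_or_nontrivial E with hE | hE
    · exact Or.inl hE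
    · right
      have : ‖((ContinuousLinearEquiv.refl ℝ E).symm : E →L[ℝ] E)‖₊ = 1 := by
        ext; exact ContinuousLinearMap.norm_id
      rwa [this, inv_one]
  have hinj : Function.Injective (fun x => x + k x) := by
    have := happ.injOn hc
    exact Set.injOn_univ.1 this
  have hsurj := happ.surjective hc
  have hin : ∀ x ∈ s, k x = h x := fun x hx => Set.indicator_of_mem hx h
  have hout : ∀ x ∉ s, k x = 0 := fun x hx => Set.indicator_of_notMem hx h
  -- Points outside `s` are fixed, so by injectivity no point of `s` can be sent to one.
  have hiff : ∀ x, x + k x ∈ s ↔ x ∈ s := by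
    intro x
    by_cases hx : x ∈ s
    · refine ⟨fun _ => hx, fun _ => ?_⟩
      by_contra hy
      have : (x + k x) + k (x + k x) = x + k x := by rw [hout _ hy, add_zero]
      have hxx := hinj this
      rw [hxx] at hy
      exact hy hx
    · rw [hout x hx, add_zero]
  refine ⟨fun x hx => ?_, fun x hx y hy hxy => ?_, fun y hy => ?_⟩
  · have := (hiff x).2 hx
    rwa [hin x hx] at this
  · apply hinj
    simpa [hin x hx, hin y hy] using hxy
  · obtain ⟨x, rfl⟩ := hsurj y
    have hx : x ∈ s := (hiff x).1 hy
    exact ⟨x, hx, by simp [hin x hx]⟩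

open MeasureTheory in
/-- A `C¹` self-map of the closed ball fixing the sphere has Jacobian determinant of integral
the volume of the ball. -/
theorem setIntegral_closedBall_det_fderiv_eq {E : Type*} [NormedAddCommGroup E]
    [NormedSpace ℝ E] [FiniteDimensional ℝ E] [MeasurableSpace E] [BorelSpace E]
    (μ : Measure E) [μ.IsAddHaarMeasure] {g : E → E} (hg : ContDiff ℝ 1 g) {ρ : ℝ} (hρ : ρ ≠ 0)
    (hfix : ∀ x, ‖x‖ = ρ → g x = x) :
    ∫ x in Metric.closedBall (0 : E) ρ, (fderiv ℝ g x).det ∂μ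
      = μ.real (Metric.closedBall (0 : E) ρ) := by
  set D := Metric.closedBall (0 : E) ρ with hD
  have hDc : IsCompact D := isCompact_closedBall 0 ρ
  let h : E → E := fun x => g x - x
  have hh : ContDiff ℝ 1 h := hg.sub contDiff_id
  have hcont : Continuous (fderiv ℝ h) := hh.continuous_fderiv one_ne_zero
  obtain ⟨C, hC⟩ := hDc.exists_bound_of_continuousOn hcont.continuousOn
  let c : NNReal := ⟨max C 0, le_max_right _ _⟩
  have hc : ∀ x ∈ D, ‖fderiv ℝ h x‖₊ ≤ c := fun x hx => (hC x hx).trans (le_max_left _ _)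
  have hlip : LipschitzOnWith c h D := Convex.lipschitzOnWith_of_nnnorm_fderiv_le
    (fun x _ => (hh.differentiable one_ne_zero) x) hc (convex_closedBall 0 ρ)
  have hfr : ∀ x ∈ frontier D, h x = 0 := by
    intro x hx
    rw [hD, frontier_closedBall _ hρ, mem_sphere_zero_iff_norm] at hx
    simp [h, hfix x hx]
  have hder : ∀ (t : ℝ) x, HasFDerivAt (fun x => x + t • h x) (1 + t • fderiv ℝ h x) x :=
    fun t x => (hasFDerivAt_id x).add ((hh.differentiable one_ne_zero x).hasFDerivAt.const_smul t)
  have hdetc : ∀ t : ℝ, Continuous fun x => (1 + t • fderiv ℝ h x).det := fun t =>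
    ContinuousLinearMap.continuous_det.comp (by fun_prop)
  have hsmall : ∀ t : ℝ, 0 ≤ t → t * c < 1 →
      ∫ x in D, (1 + t • fderiv ℝ h x).det ∂μ = μ.real D := by
    intro t ht htc
    have hlt : LipschitzOnWith (⟨t, ht⟩ * c) (fun x => t • h x) D := by
      refine LipschitzOnWith.of_dist_le_mul fun x hx y hy => ?_
      have := hlip.dist_le_mul x hx y hy
      rw [dist_smul₀, Real.norm_of_nonneg ht]
      calc t * dist (h x) (h y) ≤ t * (c * dist x y) := mul_le_mul_of_nonneg_left this ht
        _ = _ := by rw [← mul_assoc]; rfl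
    have hbij := LipschitzOnWith.bijOn_add_of_eq_zero_frontier (C := ⟨t, ht⟩ * c) htc hlt
      Metric.isClosed_closedBall (fun x hx => by rw [hfr x hx, smul_zero])
    have hcv := integral_image_eq_integral_abs_det_fderiv_smul μ
      (Metric.isClosed_closedBall.measurableSet) (fun x _ => (hder t x).hasFDerivWithinAt)
      hbij.injOn (fun _ => (1 : ℝ))
    rw [hbij.image_eq] at hcv
    simp only [smul_eq_mul, mul_one, integral_const, measureReal_restrict_apply_univ] at hcv
    rw [hcv]
    refine setIntegral_congr_fun Metric.isClosed_closedBall.measurableSet fun x hx => ?_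
    refine (abs_of_pos (ContinuousLinearMap.det_one_add_pos_of_norm_lt_one _ ?_)).symm
    rw [norm_smul, Real.norm_of_nonneg ht]
    exact lt_of_le_of_lt (mul_le_mul_of_nonneg_left (hc x hx) ht) htc
  -- Nodes below `1 / (c + 1)` satisfy `k * c < 1`; one more than the dimension determines the
  -- polynomial in `t`.
  have hpos : (0 : ℝ) < 1 / (c + 1) := by positivity
  obtain ⟨s, hsub, hcard⟩ := (Set.Ioo_infinite hpos).exists_subset_card_eq
    (Module.finrank ℝ E + 1)
  have hnode : ∀ k ∈ s, ∫ x in D, (1 + k • fderiv ℝ h x).det ∂μ = μ.real D := by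
    intro k hk
    have hk' := hsub hk
    refine hsmall k hk'.1.le ?_
    have h1 : k * (c + 1) < 1 := by
      have := hk'.2
      rwa [lt_div_iff₀ (by positivity)] at this
    nlinarith [hk'.1]
  have hg1 : ∀ x, fderiv ℝ g x = 1 + (1 : ℝ) • fderiv ℝ h x := by
    intro x
    have := (hder 1 x).fderiv
    rw [← this]
    congr 1
    ext y
    simp [h]
  have hint : ∀ t : ℝ, IntegrableOn (fun x => (1 + t • fderiv ℝ h x).det) D μ := fun t =>
    (hdetc t).continuousOn.integrableOn_compact hDc
  calc ∫ x in D, (fderiv ℝ g x).det ∂μ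
      = ∫ x in D, ∑ k ∈ s, (1 + k • fderiv ℝ h x).det * (Lagrange.basis s id k).eval 1 ∂μ := by
        congr 1
        ext x
        rw [hg1, ContinuousLinearMap.det_one_add_smul_eq_sum_lagrange _ s (by omega)]
    _ = ∑ k ∈ s, (∫ x in D, (1 + k • fderiv ℝ h x).det ∂μ) * (Lagrange.basis s id k).eval 1 := by
        rw [integral_finsetSum _ fun k _ => (hint k).mul_const _]
        simp_rw [integral_mul_const]
    _ = μ.real D * ∑ k ∈ s, (Lagrange.basis s id k).eval 1 := by
        rw [Finset.mul_sum]
        exact Finset.sum_congr rfl fun k hk => by rw [hnode k hk]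
    _ = μ.real D := by
        have hne : s.Nonempty := Finset.card_pos.1 (by omega)
        rw [← Polynomial.eval_finsetSum, Lagrange.sum_basis (Set.injOn_id _) hne,
          Polynomial.eval_one, mul_one]

/-- There is no `C¹` map into a sphere that fixes that sphere. -/
theorem not_exists_contDiff_retraction_sphere {E : Type*} [NormedAddCommGroup E]
    [InnerProductSpace ℝ E] [FiniteDimensional ℝ E] {g : E → E}
    (hg : ContDiff ℝ 1 g) {ρ : ℝ} (hρ : 0 < ρ) (hnorm : ∀ x, ‖g x‖ = ρ)
    (hfix : ∀ x, ‖x‖ = ρ → g x = x) : False := by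
  borelize E
  have h1 := setIntegral_closedBall_det_fderiv_eq MeasureTheory.volume hg hρ.ne' hfix
  -- Differentiating the constant `‖g‖ ^ 2` makes `g x` orthogonal to the range of the derivative,
  -- so `g x ≠ 0` is not in that range.
  have h2 : ∀ x, (fderiv ℝ g x).det = 0 := by
    intro x
    by_contra hdet
    have hsurj : Function.Surjective (fderiv ℝ g x) :=
      (LinearMap.equivOfDetNeZero (fderiv ℝ g x : E →ₗ[ℝ] E) hdet).surjective
    obtain ⟨v, hv⟩ := hsurj (g x)
    have hd := (hg.differentiable one_ne_zero x).hasFDerivAt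
    have h3 := hd.inner ℝ hd
    have h4 : (fun y => inner ℝ (g y) (g y)) = fun _ => ρ ^ 2 := by
      ext y
      rw [real_inner_self_eq_norm_sq, hnorm]
    rw [h4] at h3
    have h5 := DFunLike.congr_fun (h3.unique (hasFDerivAt_const _ _)) v
    simp [hv, hnorm] at h5
    exact hρ.ne' h5
  simp only [h2, MeasureTheory.integral_zero] at h1
  have : 0 < MeasureTheory.volume.real (Metric.closedBall (0 : E) ρ) :=
    ENNReal.toReal_pos (Metric.measure_closedBall_pos _ _ hρ).ne'
      (isCompact_closedBall _ _).measure_lt_top.ne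
  linarith

/-- A zero-free `f` can be smoothed within distance `‖f x‖`, which creates no zeros, and left
unchanged on `r + 1 ≤ ‖x‖`. Rescaling to norm `r + 1` then gives a forbidden retraction. -/
theorem exists_eq_zero_of_eq_self_of_norm_ge_of_innerProductSpace {E : Type*}
    [NormedAddCommGroup E] [InnerProductSpace ℝ E] [FiniteDimensional ℝ E] {f : E → E}
    (hf : Continuous f) {R : ℝ} (hfix : ∀ x, R ≤ ‖x‖ → f x = x) : ∃ x, f x = 0 := by
  by_contra! hne
  set r := max R 0 with hr
  let S : Set E := {x | r + 1 ≤ ‖x‖}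
  let U : Set E := {x | r < ‖x‖}
  have hS : IsClosed S := isClosed_le continuous_const continuous_norm
  have hUo : IsOpen U := isOpen_lt continuous_const continuous_norm
  have hSU : S ⊆ U := fun x hx => lt_of_lt_of_le (lt_add_one r) hx
  have hfU : ContDiffOn ℝ (1 : ℕ∞) f U := contDiffOn_id.congr fun x hx =>
    hfix x ((le_max_left R 0).trans (le_of_lt hx))
  obtain ⟨g, hg, happ, heq, -⟩ := hf.exists_contDiff_approx_and_eqOn 1 hf.norm
    (fun x => norm_pos_iff.2 (hne x)) hS (hUo.mem_nhdsSet.2 hSU) hfU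
  have hg0 : ∀ x, g x ≠ 0 := by
    intro x h0
    have := happ x
    rw [h0, dist_zero_left] at this
    exact lt_irrefl _ this
  have hpos : 0 < r + 1 := by positivity
  refine not_exists_contDiff_retraction_sphere (g := fun x => ((r + 1) * ‖g x‖⁻¹) • g x)
    ?_ hpos ?_ ?_
  · have hn : ContDiff ℝ 1 fun x => ‖g x‖ := hg.norm ℝ hg0
    exact (contDiff_const.mul (hn.inv fun x => norm_ne_zero_iff.2 (hg0 x))).smul hg
  · intro x
    have := norm_ne_zero_iff.2 (hg0 x)
    rw [norm_smul, norm_mul, norm_inv, norm_norm, Real.norm_of_nonneg hpos.le]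
    field_simp
  · intro x hx
    have hgx : g x = x := by
      rw [heq (show x ∈ S from hx.ge)]
      exact hfix x ((le_max_left R 0).trans (by rw [hx]; linarith))
    rw [hgx, hx, mul_inv_cancel₀ hpos.ne', one_smul]

/-- A continuous self-map of a finite-dimensional space that is the identity outside a ball
has a zero. -/
theorem exists_eq_zero_of_eq_self_of_norm_ge {E : Type*}
    [NormedAddCommGroup E] [NormedSpace ℝ E] [FiniteDimensional ℝ E] {f : E → E}
    (hf : Continuous f) {R : ℝ} (hfix : ∀ x, R ≤ ‖x‖ → f x = x) : ∃ x, f x = 0 := by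
  let e := toEuclidean (E := E)
  obtain ⟨x, hx⟩ := exists_eq_zero_of_eq_self_of_norm_ge_of_innerProductSpace
    (f := fun x => e (f (e.symm x))) (R := ‖e.toContinuousLinearMap‖ * max R 0 + 1)
    (by fun_prop) (fun x hx => by
      have h1 := e.toContinuousLinearMap.le_opNorm (e.symm x)
      simp only [ContinuousLinearEquiv.coe_coe, ContinuousLinearEquiv.apply_symm_apply] at h1
      have h2 : R ≤ ‖e.symm x‖ := by
        by_contra! hlt
        have := mul_le_mul_of_nonneg_left (hlt.le.trans (le_max_left R 0))
          (norm_nonneg e.toContinuousLinearMap)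
        linarith
      rw [hfix _ h2, ContinuousLinearEquiv.apply_symm_apply])
  exact ⟨e.symm x, e.map_eq_zero_iff.1 hx⟩

/-! ### Nontriviality of `πₙ(Sⁿ)` -/

/-- The affine bijection from the unit cube onto the cube `[-1, 1]ⁿ`. -/
def cubeToSymmetricCube {n : ℕ} (y : Fin n → unitInterval) : Fin n → ℝ := fun i => 2 * (y i : ℝ) - 1

theorem continuous_cubeToSymmetricCube {n : ℕ} :
    Continuous (cubeToSymmetricCube : (Fin n → unitInterval) → Fin n → ℝ) := by
  unfold cubeToSymmetricCube
  fun_prop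

theorem norm_cubeToSymmetricCube_of_mem_boundary {n : ℕ} {y : Fin n → unitInterval}
    (hy : y ∈ Cube.boundary (Fin n)) : ‖cubeToSymmetricCube y‖ = 1 := by
  apply le_antisymm
  · refine (pi_norm_le_iff_of_nonneg zero_le_one).2 fun i => ?_
    have h0 := (y i).2.1
    have h1 := (y i).2.2
    rw [Real.norm_eq_abs, abs_le]
    constructor <;> simp only [cubeToSymmetricCube] <;> linarith
  · obtain ⟨i, hi⟩ := hy
    refine le_trans (le_of_eq ?_) (norm_le_pi_norm _ i)
    rcases hi with hi | hi <;> norm_num [cubeToSymmetricCube, hi]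

/-- A map from the cube to the punctured space `ℝ × ℝⁿ` that winds once around the origin: it sends the boundary to `(-1, 0)` and the centre to `(1, 0)`. -/
noncomputable def cubeToPunctured {n : ℕ} (y : Fin n → unitInterval) : ℝ × (Fin n → ℝ) :=
  (1 - 2 * ‖cubeToSymmetricCube y‖,
    (2 * (1 - ‖cubeToSymmetricCube y‖)) • cubeToSymmetricCube y)

theorem continuous_cubeToPunctured {n : ℕ} :
    Continuous (cubeToPunctured : (Fin n → unitInterval) → ℝ × (Fin n → ℝ)) := by
  have := continuous_cubeToSymmetricCube (n := n)
  unfold cubeToPunctured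
  fun_prop

theorem cubeToPunctured_of_mem_boundary {n : ℕ} {y : Fin n → unitInterval}
    (hy : y ∈ Cube.boundary (Fin n)) : cubeToPunctured y = (-1, 0) := by
  rw [cubeToPunctured, norm_cubeToSymmetricCube_of_mem_boundary hy]
  norm_num

theorem cubeToPunctured_ne_zero {n : ℕ} (y : Fin n → unitInterval) : cubeToPunctured y ≠ 0 := by
  intro h
  rw [cubeToPunctured, Prod.mk_eq_zero] at h
  have h1 : ‖cubeToSymmetricCube y‖ = 1 / 2 := by linarith [h.1]
  have h2 := h.2
  rw [h1] at h2
  have h3 : cubeToSymmetricCube y = 0 := by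
    rcases smul_eq_zero.1 h2 with h4 | h4
    · norm_num at h4
    · exact h4
  rw [h3, norm_zero] at h1
  norm_num at h1

/-- The radial projection of a nonzero vector to the unit sphere. -/
noncomputable def toUnitSphere {V : Type*} [NormedAddCommGroup V] [NormedSpace ℝ V]
    (v : V) (hv : v ≠ 0) : Metric.sphere (0 : V) 1 :=
  ⟨‖v‖⁻¹ • v, by simp [norm_smul, hv]⟩

/-- The clamped coordinates of a point of `ℝⁿ`, as a point of the unit cube. -/
noncomputable def clampToCube {n : ℕ} (x : Fin n → ℝ) : Fin n → unitInterval :=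
  fun i => Set.projIcc 0 1 zero_le_one ((x i + 1) / 2)

theorem continuous_clampToCube {n : ℕ} :
    Continuous (clampToCube : (Fin n → ℝ) → Fin n → unitInterval) :=
  continuous_pi fun i => continuous_projIcc.comp (by fun_prop)

theorem clampToCube_mem_boundary {n : ℕ} {x : Fin n → ℝ} {i : Fin n} (hi : 1 ≤ |x i|) :
    clampToCube x ∈ Cube.boundary (Fin n) := by
  refine ⟨i, ?_⟩
  rcases le_abs.1 hi with h | h
  · exact Or.inr (Set.projIcc_of_right_le _ (by linarith))
  · exact Or.inl (Set.projIcc_of_le_left _ (by linarith))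

theorem mul_cubeToSymmetricCube_clampToCube_nonneg {n : ℕ} (x : Fin n → ℝ) (i : Fin n) :
    0 ≤ x i * cubeToSymmetricCube (clampToCube x) i := by
  simp only [cubeToSymmetricCube, clampToCube, Set.coe_projIcc]
  rcases le_total 0 (x i) with h | h
  · refine mul_nonneg h ?_
    have : 1 / 2 ≤ max 0 (min 1 ((x i + 1) / 2)) :=
      le_max_of_le_right (le_min (by norm_num) (by linarith))
    linarith
  · refine mul_nonneg_of_nonpos_of_nonpos h ?_
    have : max 0 (min 1 ((x i + 1) / 2)) ≤ 1 / 2 :=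
      max_le (by norm_num) (min_le_of_right_le (by linarith))
    linarith

/-- Clamping preserves the signs of coordinates, so opposite directions force `x.2 = 0`; the value
there is `(1, 0)`, which is not opposite to `x` when `0 ≤ x.1`. -/
theorem cubeToPunctured_clampToCube_ne_neg_smul {n : ℕ} {x : ℝ × (Fin n → ℝ)} (hx : 0 ≤ x.1)
    {a c : ℝ} (ha : 0 < a) (hc : 0 < c) :
    a • cubeToPunctured (clampToCube x.2) ≠ -(c • x) := by
  intro h
  have hle : ‖cubeToSymmetricCube (clampToCube x.2)‖ ≤ 1 := by
    refine (pi_norm_le_iff_of_nonneg zero_le_one).2 fun i => ?_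
    have h0 := (clampToCube x.2 i).2.1
    have h1 := (clampToCube x.2 i).2.2
    rw [Real.norm_eq_abs, abs_le]
    constructor <;> simp only [cubeToSymmetricCube] <;> linarith
  have hx2 : x.2 = 0 := by
    ext i
    have hi := congrFun (congrArg Prod.snd h) i
    simp only [cubeToPunctured, Prod.smul_snd, Prod.snd_neg, Pi.smul_apply, Pi.neg_apply,
      smul_eq_mul] at hi
    have h1 := mul_cubeToSymmetricCube_clampToCube_nonneg x.2 i
    have h2 : c * (x.2 i * x.2 i) = -(a * (2 * (1 - ‖cubeToSymmetricCube (clampToCube x.2)‖))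
        * (x.2 i * cubeToSymmetricCube (clampToCube x.2) i)) := by
      linear_combination x.2 i * hi
    have h3 : 0 ≤ a * (2 * (1 - ‖cubeToSymmetricCube (clampToCube x.2)‖))
        * (x.2 i * cubeToSymmetricCube (clampToCube x.2) i) :=
      mul_nonneg (mul_nonneg ha.le (by linarith)) h1
    have h4 : x.2 i * x.2 i ≤ 0 := by
      by_contra! h5
      have := mul_pos hc h5
      linarith
    exact mul_self_eq_zero.1 (le_antisymm h4 (mul_self_nonneg _))
  have hz : cubeToSymmetricCube (clampToCube x.2) = 0 := by
    ext i
    simp [cubeToSymmetricCube, clampToCube, hx2, Set.coe_projIcc]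
    norm_num
  have h1 := congrArg Prod.fst h
  simp only [cubeToPunctured, hz, Prod.smul_fst, Prod.fst_neg, smul_eq_mul, norm_zero] at h1
  nlinarith [mul_nonneg hc.le hx]

/-- The unit sphere of an `(n + 1)`-dimensional normed space has a nontrivial `n`-th homotopy
group. -/
theorem exists_not_subsingleton_homotopyGroup_sphere {V : Type*} [NormedAddCommGroup V]
    [NormedSpace ℝ V] [FiniteDimensional ℝ V] {n : ℕ} (hn : Module.finrank ℝ V = n + 1) :
    ∃ x : Metric.sphere (0 : V) 1, ¬ Subsingleton (π_ n (Metric.sphere (0 : V) 1) x) := by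
  have hfr : Module.finrank ℝ (ℝ × (Fin n → ℝ)) = Module.finrank ℝ V := by
    rw [hn, Module.finrank_prod, Module.finrank_self, Module.finrank_fin_fun, add_comm]
  let L : (ℝ × (Fin n → ℝ)) ≃L[ℝ] V := ContinuousLinearEquiv.ofFinrankEq hfr
  have hL : ∀ {w}, w ≠ 0 → L w ≠ 0 := fun hw => mt L.map_eq_zero_iff.1 hw
  have hb : ((-1, 0) : ℝ × (Fin n → ℝ)) ≠ 0 := by simp
  let base := toUnitSphere (L (-1, 0)) (hL hb)
  refine ⟨base, fun hsub => ?_⟩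
  let p : GenLoop (Fin n) (Metric.sphere (0 : V) 1) base :=
    ⟨⟨fun y => toUnitSphere (L (cubeToPunctured y)) (hL (cubeToPunctured_ne_zero y)), by
        have hc : Continuous fun y : Fin n → unitInterval => L (cubeToPunctured y) :=
          L.continuous.comp continuous_cubeToPunctured
        exact Continuous.subtype_mk ((hc.norm.inv₀ fun y =>
          norm_ne_zero_iff.2 (hL (cubeToPunctured_ne_zero y))).smul hc) _⟩,
      fun y hy => Subtype.ext <| by
        change ‖L (cubeToPunctured y)‖⁻¹ • L (cubeToPunctured y) = _
        rw [cubeToPunctured_of_mem_boundary hy]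
        rfl⟩
  have hhom : GenLoop.Homotopic p GenLoop.const :=
    Quotient.exact (hsub.elim (Quotient.mk _ p) (Quotient.mk _ GenLoop.const))
  obtain ⟨H⟩ := hhom
  -- Homotopy time runs along the first axis, from `p` at `x.1 ≥ 1` to the constant loop at `x.1 ≤
  -- -1`. The parameter `s` blends the resulting map `G` into the identity for norms between 1 and
  -- 2.
  let τ : ℝ × (Fin n → ℝ) → unitInterval := fun x => Set.projIcc 0 1 zero_le_one ((1 - x.1) / 2)
  let s : ℝ × (Fin n → ℝ) → unitInterval := fun x => Set.projIcc 0 1 zero_le_one (‖x‖ - 1)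
  let G : ℝ × (Fin n → ℝ) → Metric.sphere (0 : V) 1 := fun x => H (τ x, clampToCube x.2)
  have hτ : Continuous τ := continuous_projIcc.comp (by fun_prop)
  have hs : Continuous s := continuous_projIcc.comp (by fun_prop)
  have hG : Continuous G :=
    H.continuous.comp (hτ.prodMk (continuous_clampToCube.comp continuous_snd))
  let f : ℝ × (Fin n → ℝ) → ℝ × (Fin n → ℝ) := fun x =>
    (1 - (s x : ℝ)) • L.symm (G x) + (s x : ℝ) • x
  have hf : Continuous f := by fun_prop
  obtain ⟨x, hx⟩ := exists_eq_zero_of_eq_self_of_norm_ge hf (R := 2) fun x hx => by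
    have : s x = 1 := Set.projIcc_of_right_le _ (by linarith)
    simp [f, this]
  have hG0 : L.symm (G x) ≠ 0 := fun h0 => by
    have h1 : (G x : V) = 0 := L.symm.map_eq_zero_iff.1 h0
    have h2 : ‖(G x : V)‖ = 1 := mem_sphere_zero_iff_norm.1 (G x).2
    rw [h1, norm_zero] at h2
    exact zero_ne_one h2
  have hLs : ∀ (w) (hw : L w ≠ 0), L.symm (toUnitSphere (L w) hw) = ‖L w‖⁻¹ • w := fun w hw => by
    simp [toUnitSphere]
  rcases le_or_gt ‖x‖ 1 with hle | hgt
  · have : s x = 0 := Set.projIcc_of_le_left _ (by linarith)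
    simp only [f, this] at hx
    simp at hx
    exact hG0 (by simp [hx])
  have hs0 : 0 < (s x : ℝ) := by
    simp only [s, Set.coe_projIcc]
    exact lt_max_of_lt_right (lt_min one_pos (by linarith))
  have hs1 : (s x : ℝ) < 1 := by
    refine lt_of_le_of_ne (s x).2.2 fun h1 => ?_
    simp only [f, h1] at hx
    have : x = 0 := by simpa using hx
    rw [this, norm_zero] at hgt
    linarith
  have hx' : (1 - (s x : ℝ)) • L.symm (G x) = -((s x : ℝ) • x) := eq_neg_of_add_eq_zero_left hx
  -- The base point has direction `(-1, 0)`, so cancellation with `x` puts `x` on the positive first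
  -- axis.
  have hbase : G x = base → x.2 = 0 ∧ 0 < x.1 := by
    intro h
    rw [h, hLs _ (hL hb), smul_smul] at hx'
    have hpos : 0 < (1 - (s x : ℝ)) * ‖L (-1, 0)‖⁻¹ :=
      mul_pos (by linarith) (inv_pos.2 (norm_pos_iff.2 (hL hb)))
    have h1 := congrArg Prod.fst hx'
    have h2 := congrArg Prod.snd hx'
    simp only [Prod.smul_snd, Prod.smul_fst, Prod.snd_neg, Prod.fst_neg, smul_zero,
      smul_eq_mul] at h1 h2
    refine ⟨?_, ?_⟩
    · exact (smul_eq_zero.1 (neg_eq_zero.1 h2.symm)).resolve_left hs0.ne'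
    · by_contra! h3
      nlinarith [mul_nonneg hs0.le (neg_nonneg.2 h3)]
  -- Since the max norm of `x` exceeds 1, either `|x.1| ≥ 1` or some coordinate of `x.2` has
  -- absolute value at least 1, where `G x = base`.
  rcases le_or_gt 1 x.1 with h1 | h1
  · have hτ0 : τ x = 0 := Set.projIcc_of_le_left _ (by linarith)
    have hGp : G x = p (clampToCube x.2) := by
      simp only [G, hτ0]
      exact H.apply_zero _
    have hne := hL (cubeToPunctured_ne_zero (clampToCube x.2))
    have hp : p (clampToCube x.2) = toUnitSphere _ hne := rfl
    rw [hGp, hp, hLs _ hne, smul_smul] at hx'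
    exact cubeToPunctured_clampToCube_ne_neg_smul (by linarith)
      (mul_pos (by linarith) (inv_pos.2 (norm_pos_iff.2 hne))) hs0 hx'
  rcases le_or_gt x.1 (-1) with h2 | h2
  · have hτ1 : τ x = 1 := Set.projIcc_of_right_le _ (by linarith)
    have := (hbase (by simp only [G, hτ1]; exact H.apply_one _)).2
    linarith
  · have h3 : 1 < ‖x.2‖ := by
      rw [Prod.norm_def, lt_max_iff] at hgt
      refine hgt.resolve_left ?_
      rw [Real.norm_eq_abs, not_lt, abs_le]
      exact ⟨h2.le, h1.le⟩
    obtain ⟨i, hi⟩ : ∃ i, 1 ≤ |x.2 i| := by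
      by_contra! h4
      exact h3.not_ge ((pi_norm_le_iff_of_nonneg zero_le_one).2 fun i => (h4 i).le)
    have hy := clampToCube_mem_boundary hi
    have h5 := (hbase ((H.eq_fst _ hy).trans (p.2 _ hy))).1
    rw [h5] at h3
    simp at h3
    linarith

/-! ### The sphere as a retract of the moment-angle complex -/

/-- A retract of an aspherical space is aspherical. -/
theorem IsAspherical.of_leftInverse {X Y : Type*} [TopologicalSpace X] [TopologicalSpace Y]
    (hY : IsAspherical Y) (i : C(X, Y)) (r : C(Y, X)) (hri : Function.LeftInverse r i) :
    IsAspherical X := by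
  intro n hn x
  have hsub := hY n hn (i x)
  let push : GenLoop (Fin n) X x → GenLoop (Fin n) Y (i x) := fun p =>
    ⟨i.comp p.1, fun y hy => congrArg i (p.2 y hy)⟩
  refine ⟨fun a b => ?_⟩
  induction a using Quotient.inductionOn with | _ p
  induction b using Quotient.inductionOn with | _ q
  have hpq : GenLoop.Homotopic (push p) (push q) :=
    Quotient.exact (hsub.elim (Quotient.mk _ (push p)) (Quotient.mk _ (push q)))
  refine Quotient.sound ?_
  have hback : ∀ p : GenLoop (Fin n) X x, r.comp (push p).1 = p.1 := fun p => by
    ext y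
    exact hri _
  have := ContinuousMap.HomotopicRel.comp_continuousMap hpq r
  rw [hback, hback] at this
  exact this

/-- The projection to two coordinates that span no edge maps the moment-angle complex to the
boundary of the product of two balls. -/
theorem mem_sphere_of_mem_quaternionicMomentAngleComplex {ι : Type*} [DecidableEq ι]
    {K : PreAbstractSimplicialComplex ι} {i j : ι} (hK : {i, j} ∉ K)
    {x : ι → ℍ[ℝ]} (hx : x ∈ quaternionicMomentAngleComplex K) :
    (x i, x j) ∈ Metric.sphere (0 : ℍ[ℝ] × ℍ[ℝ]) 1 := by
  obtain ⟨J, hJ, hD, hS⟩ := hx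
  have hle : ∀ k, ‖x k‖ ≤ 1 := fun k => by
    by_cases hk : k ∈ J
    · exact mem_closedBall_zero_iff.1 (hD k hk)
    · exact (mem_sphere_zero_iff_norm.1 (hS k hk)).le
  have hor : i ∉ J ∨ j ∉ J := by
    by_contra! h
    rcases hJ with rfl | hJ
    · simp at h
    · exact hK (K.isRelLowerSet_faces.mem_of_le hJ
        (Finset.insert_subset h.1 (Finset.singleton_subset_iff.2 h.2)) (by simp))
  rw [mem_sphere_zero_iff_norm, Prod.norm_mk]
  rcases hor with h | h
  · rw [mem_sphere_zero_iff_norm.1 (hS i h), max_eq_left (hle j)]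
  · rw [mem_sphere_zero_iff_norm.1 (hS j h), max_eq_right (hle i)]

/-- For two vertices, the boundary of the product of two balls embeds in the moment-angle complex
when the other coordinates are set to `1`. -/
theorem update_mem_quaternionicMomentAngleComplex {ι : Type*} [DecidableEq ι]
    {K : PreAbstractSimplicialComplex ι} {i j : ι} (hij : j ≠ i) (hi : {i} ∈ K) (hj : {j} ∈ K)
    {z : ℍ[ℝ] × ℍ[ℝ]} (hz : z ∈ Metric.sphere (0 : ℍ[ℝ] × ℍ[ℝ]) 1) :
    Function.update (Function.update (fun _ => 1) i z.1) j z.2 ∈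
      quaternionicMomentAngleComplex K := by
  rw [mem_sphere_zero_iff_norm, Prod.norm_def] at hz
  -- The coordinate attaining the maximum lies on `S³`, so the simplex spanned by the other vertex
  -- alone suffices.
  rcases max_choice ‖z.1‖ ‖z.2‖ with h | h
  · refine ⟨{j}, Or.inr hj, fun k hk => ?_, fun k hk => ?_⟩
    · rw [Finset.mem_singleton.1 hk, Function.update_self, mem_closedBall_zero_iff]
      exact (le_max_right _ _).trans hz.le
    · rw [Finset.mem_singleton] at hk
      rw [Function.update_of_ne hk, mem_sphere_zero_iff_norm]
      by_cases hki : k = i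
      · rw [hki, Function.update_self, ← h, hz]
      · rw [Function.update_of_ne hki, norm_one]
  · refine ⟨{i}, Or.inr hi, fun k hk => ?_, fun k hk => ?_⟩
    · rw [Finset.mem_singleton.1 hk, Function.update_of_ne hij.symm, Function.update_self,
        mem_closedBall_zero_iff]
      exact (le_max_left _ _).trans hz.le
    · rw [Finset.mem_singleton] at hk
      rw [mem_sphere_zero_iff_norm]
      by_cases hkj : k = j
      · rw [hkj, Function.update_self, ← h, hz]
      · rw [Function.update_of_ne hkj, Function.update_of_ne hk, norm_one]

theorem lemma2p4 (m : ℕ) (K : PreAbstractSimplicialComplex (Fin m))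
    (hK : ∃ i : Fin m, {i} ∈ K ∧ ¬ IsConelike K i) :
    ¬ IsAspherical (quaternionicMomentAngleComplex K) := by
  obtain ⟨i, hi, hcone⟩ := hK
  simp only [IsConelike, not_forall] at hcone
  obtain ⟨j, hij, hj, hedge⟩ := hcone
  intro hasph
  let incl : C(Metric.sphere (0 : ℍ[ℝ] × ℍ[ℝ]) 1, quaternionicMomentAngleComplex K) :=
    ⟨fun z => ⟨_, update_mem_quaternionicMomentAngleComplex hij hi hj z.2⟩,
      Continuous.subtype_mk (Continuous.update (Continuous.update continuous_const i
        (continuous_fst.comp continuous_subtype_val)) j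
        (continuous_snd.comp continuous_subtype_val)) fun z =>
          update_mem_quaternionicMomentAngleComplex hij hi hj z.2⟩
  let proj : C(quaternionicMomentAngleComplex K, Metric.sphere (0 : ℍ[ℝ] × ℍ[ℝ]) 1) :=
    ⟨fun x => ⟨_, mem_sphere_of_mem_quaternionicMomentAngleComplex hedge x.2⟩,
      Continuous.subtype_mk (((continuous_apply i).comp continuous_subtype_val).prodMk
        ((continuous_apply j).comp continuous_subtype_val)) _⟩
  have hretract : Function.LeftInverse proj incl := fun z => by
    ext1
    simp [proj, incl, Function.update_of_ne hij.symm]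
  have hdim : Module.finrank ℝ (ℍ[ℝ] × ℍ[ℝ]) = 7 + 1 := by
    rw [Module.finrank_prod, Quaternion.finrank_eq_four]
  obtain ⟨x, hx⟩ := exists_not_subsingleton_homotopyGroup_sphere hdim
  exact hx (hasph.of_leftInverse incl proj hretract 7 (by norm_num) x)
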